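/- For every $d$ there is a constant $C_d>0$, depending only on $d$, such that the following holds for every convex body $K\subset\mathbb R^d$, i.e. every closed bounded convex set with non-empty interior. Write $v+K=\{v+x:x\in K\}$ for $v\in\mathbb R^d$ and $K-K=\{x-y:x,y\in K\}$. The sets $\mathbb Z^d\cap(v+K)$, $v\in\mathbb R^d$, and $\mathbb Z^d\cap(K-K)$ are finite, the maximum $\max_{v\in\mathbb R^d}|\mathbb Z^d\cap(v+K)|$ is attained, and $$\max_{v\in\mathbb R^d}|\mathbb Z^d\cap(v+K)|\;\le\;|\mathbb Z^d\cap(K-K)|\;\le\; C_d\,\max_{v\in\mathbb R^d}|\mathbb Z^d\cap(v+K)|.$$ -/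

import Mathlib

open scoped Pointwise

/-- The integer lattice `ℤ^d`, as a subset of Euclidean space `ℝ^d`. -/
def integerLattice (d : ℕ) : Set (EuclideanSpace ℝ (Fin d)) :=
  {x | ∀ i, ∃ n : ℤ, x i = (n : ℝ)}

/-! Every compact convex `K` in a space of dimension `d` admits a covering of `K - K` by
`(4 * d + 1) ^ d` translates of `K`, and then one of these translates has to contain a fair share of
the lattice points of `K - K`. To find the covering, put a point of `K` at the origin and choose
`v 0, …, v (k - 1)` in `K` so that the simplex with these vertices and the origin has maximal
volume, where `k` is the dimension of the span of `K`. By Cramer's rule and maximality, every point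
of `K` has coordinates in `[-1, 1]` with respect to `v`, so `K - K` has coordinates in `[-2, 2]`.
Cutting `[-2, 2]^k` into cubes of side `1 / k` gives the covering: up to translation such a cube
lies in the simplex of nonnegative coordinates with sum at most `1`, hence in `K`. -/

/-- The full-dimensional simplex spanned by the origin and the standard basis vectors of `ι → ℝ`.
Every simplex with a vertex at the origin is a linear image of it. Unlike in `stdSimplex`, the
coordinates may add up to less than `1`. -/
def cornerSimplex (ι : Type*) [Fintype ι] : Set (ι → ℝ) :=
  {c | (∀ i, 0 ≤ c i) ∧ ∑ i, c i ≤ 1}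

theorem Icc_zero_inv_card_subset_cornerSimplex {ι : Type*} [Fintype ι] :
    Set.Icc 0 (fun _ => (Fintype.card ι : ℝ)⁻¹) ⊆ cornerSimplex ι := by
  rintro c ⟨hc0, hc1⟩
  refine ⟨hc0, ?_⟩
  calc ∑ i, c i ≤ ∑ _i : ι, (Fintype.card ι : ℝ)⁻¹ := Finset.sum_le_sum fun i _ => hc1 i
    _ = Fintype.card ι * (Fintype.card ι : ℝ)⁻¹ := by simp
    _ ≤ 1 := mul_inv_le_one

theorem exists_int_sub_div_mem_Icc_zero_inv {n m : ℕ} (hn : n ≠ 0) {x : ℝ} (hx : |x| ≤ m) :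
    ∃ a ∈ Finset.Icc (-(m * n : ℤ)) (m * n), x - a / n ∈ Set.Icc 0 (n : ℝ)⁻¹ := by
  obtain ⟨hl, hr⟩ := abs_le.mp hx
  have hsub : x - ⌊n * x⌋ / n = Int.fract (n * x) / n := by
    rw [Int.fract]
    field_simp
  refine ⟨⌊n * x⌋, Finset.mem_Icc.mpr ⟨Int.le_floor.mpr ?_, Int.floor_le_iff.mpr ?_⟩, ?_⟩
  · push_cast
    nlinarith [mul_le_mul_of_nonneg_left hl n.cast_nonneg]
  · push_cast
    nlinarith [mul_le_mul_of_nonneg_left hr n.cast_nonneg]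
  · rw [hsub, inv_eq_one_div]
    exact ⟨by positivity, by gcongr; exact (Int.fract_lt_one _).le⟩

theorem exists_finset_card_le_Icc_subset_add_cornerSimplex (ι : Type*) [Fintype ι] (m : ℕ) :
    ∃ T : Finset (ι → ℝ), T.card ≤ (2 * m * Fintype.card ι + 1) ^ Fintype.card ι ∧
      Set.Icc (-m : ι → ℝ) m ⊆ T + cornerSimplex ι := by
  classical
  let n := Fintype.card ι
  let grid : Finset (ι → ℤ) := Fintype.piFinset fun _ => Finset.Icc (-(m * n : ℤ)) (m * n)
  have hgrid : grid.card = (2 * m * n + 1) ^ n := by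
    simp only [grid, Fintype.card_piFinset, Finset.prod_const, Finset.card_univ, Int.card_Icc]
    congr 1
    lia
  refine ⟨grid.image fun a i => (a i : ℝ) / n, Finset.card_image_le.trans hgrid.le, ?_⟩
  rintro x ⟨hl, hr⟩
  have hcoord (i : ι) := exists_int_sub_div_mem_Icc_zero_inv (n := n)
    (haveI := Nonempty.intro i; Fintype.card_ne_zero) (abs_le.mpr ⟨hl i, hr i⟩)
  choose a ha hxa using hcoord
  refine Set.mem_add.mpr ⟨fun i => a i / n, ?_, fun i => x i - a i / n, ?_, ?_⟩
  · exact Finset.mem_coe.mpr (Finset.mem_image_of_mem _ (Fintype.mem_piFinset.mpr ha))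
  · exact Icc_zero_inv_card_subset_cornerSimplex ⟨fun i => (hxa i).1, fun i => (hxa i).2⟩
  · exact funext fun i => add_sub_cancel _ _

theorem linearCombination_image_cornerSimplex_subset {ι E : Type*} [Fintype ι]
    [AddCommGroup E] [Module ℝ E] {S : Set E} (hS : Convex ℝ S) (h0 : 0 ∈ S) {v : ι → E}
    (hv : ∀ i, v i ∈ S) :
    Fintype.linearCombination ℝ v '' cornerSimplex ι ⊆ S := by
  rintro _ ⟨c, ⟨hc0, hc1⟩, rfl⟩
  -- The weight missing from `∑ i, c i` goes to the vertex `0`, indexed by `none`.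
  have hmem := hS.sum_mem (t := Finset.univ) (w := fun o : Option ι => o.elim (1 - ∑ i, c i) c)
    (z := fun o => o.elim 0 v)
    (by rintro (_ | i) _ <;> simp [hc0, hc1])
    (by simp [Fintype.sum_option])
    (by rintro (_ | i) _ <;> simp [h0, hv])
  simpa [Fintype.sum_option, Fintype.linearCombination_apply] using hmem

theorem exists_basis_mem_of_span_eq_top {𝕜 V : Type*} [Field 𝕜] [AddCommGroup V] [Module 𝕜 V]
    [FiniteDimensional 𝕜 V] {S : Set V} (hS : Submodule.span 𝕜 S = ⊤) :
    ∃ v : Module.Basis (Fin (Module.finrank 𝕜 V)) 𝕜 V, ∀ i, v i ∈ S := by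
  let u := Module.Basis.ofSpan hS.ge
  refine ⟨u.reindex (u.indexEquiv (Module.finBasis 𝕜 V)), fun i => ?_⟩
  rw [Module.Basis.reindex_apply]
  exact Module.Basis.ofSpan_subset hS.ge (Set.mem_range_self _)

theorem continuous_basis_det {𝕜 V ι : Type*} [NontriviallyNormedField 𝕜] [CompleteSpace 𝕜]
    [AddCommGroup V] [Module 𝕜 V] [TopologicalSpace V] [IsTopologicalAddGroup V]
    [ContinuousSMul 𝕜 V] [T2Space V] [Fintype ι] [DecidableEq ι] (b : Module.Basis ι 𝕜 V) :
    Continuous b.det := by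
  simp only [funext b.det_apply]
  refine Continuous.matrix_det (continuous_matrix fun i j => ?_)
  exact (continuous_apply i).comp ((continuous_equivFun_basis b).comp (continuous_apply j))

section Covering

variable {E : Type*} [AddCommGroup E] [Module ℝ E] [TopologicalSpace E] [IsTopologicalAddGroup E]
  [ContinuousSMul ℝ E] [T2Space E] [FiniteDimensional ℝ E]

theorem exists_basis_mem_abs_repr_le_one {S : Set E} (hS : IsCompact S)
    (hspan : Submodule.span ℝ S = ⊤) :
    ∃ v : Module.Basis (Fin (Module.finrank ℝ E)) ℝ E,
      (∀ i, v i ∈ S) ∧ ∀ x ∈ S, ∀ i, |v.repr x i| ≤ 1 := by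
  obtain ⟨b, hb⟩ := exists_basis_mem_of_span_eq_top hspan
  obtain ⟨p, hpS, hpmax⟩ := (isCompact_univ_pi fun _ => hS).exists_isMaxOn
    ⟨b, fun i _ => hb i⟩ (continuous_basis_det b).abs.continuousOn
  have hpos : 0 < |b.det p| := by
    have : |b.det b| ≤ |b.det p| := hpmax fun i _ => hb i
    rw [b.det_self, abs_one] at this
    exact one_pos.trans_le this
  obtain ⟨hli, hsp⟩ := b.is_basis_iff_det.mpr (abs_pos.mp hpos).isUnit
  refine ⟨.mk hli hsp.ge, fun i => by simpa using hpS i trivial, fun x hx i => ?_⟩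
  have cramer : b.det p * (Module.Basis.mk hli hsp.ge).repr x i = b.det (Function.update p i x) :=
    congr($(b.det_smul_mk_coord_eq_det_update hli hsp.ge i) x)
  have hmax : |b.det (Function.update p i x)| ≤ |b.det p| :=
    hpmax ((Set.update_mem_pi_iff_of_mem hpS).mpr fun _ => hx)
  rw [← cramer, abs_mul] at hmax
  exact (mul_le_iff_le_one_right hpos).mp hmax

theorem exists_subset_linearCombination_image_Icc {S : Set E} (hS : IsCompact S) :
    ∃ v : Fin (Module.finrank ℝ (Submodule.span ℝ S)) → E,
      (∀ i, v i ∈ S) ∧ S ⊆ Fintype.linearCombination ℝ v '' Set.Icc (-1) 1 := by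
  let W := Submodule.span ℝ S
  have hcompact : IsCompact ((↑) ⁻¹' S : Set W) :=
    W.closed_of_finiteDimensional.isClosedEmbedding_subtypeVal.isCompact_preimage hS
  obtain ⟨v, hvS, hv⟩ :=
    exists_basis_mem_abs_repr_le_one hcompact Submodule.span_span_coe_preimage
  refine ⟨fun i => v i, hvS, fun x hx => ?_⟩
  let x' : W := ⟨x, Submodule.subset_span hx⟩
  refine ⟨v.repr x', ⟨fun i => (abs_le.mp (hv x' hx i)).1, fun i => (abs_le.mp (hv x' hx i)).2⟩, ?_⟩
  simpa only [Fintype.linearCombination_apply, Submodule.coe_sum, Submodule.coe_smul] using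
    congr(($(v.sum_repr x') : E))

theorem exists_finset_card_le_sub_subset_add_of_zero_mem {S : Set E} (hcomp : IsCompact S)
    (hconv : Convex ℝ S) (h0 : 0 ∈ S) :
    ∃ T : Finset E, T.card ≤ (4 * Module.finrank ℝ E + 1) ^ Module.finrank ℝ E ∧
      S - S ⊆ T + S := by
  classical
  obtain ⟨v, hvS, hv⟩ := exists_subset_linearCombination_image_Icc hcomp
  let f := Fintype.linearCombination ℝ v
  obtain ⟨T, hTcard, hT⟩ := exists_finset_card_le_Icc_subset_add_cornerSimplex
    (Fin (Module.finrank ℝ (Submodule.span ℝ S))) 2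
  refine ⟨T.image f, ?_, ?_⟩
  · have hrank := (Submodule.span ℝ S).finrank_le
    rw [Fintype.card_fin] at hTcard
    calc (T.image f).card ≤ T.card := Finset.card_image_le
      _ ≤ _ := hTcard
      _ ≤ _ := by gcongr; lia
  · calc S - S ⊆ f '' Set.Icc (-1) 1 - f '' Set.Icc (-1) 1 := Set.sub_subset_sub hv hv
      _ = f '' (Set.Icc (-1) 1 - Set.Icc (-1) 1) := (Set.image_sub f).symm
      _ ⊆ f '' Set.Icc (-(2 : ℕ)) (2 : ℕ) := by
        refine Set.image_mono ?_
        rw [sub_eq_add_neg, Set.neg_Icc, neg_neg]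
        exact (Set.Icc_add_Icc_subset _ _ _ _).trans_eq (by norm_num)
      _ ⊆ f '' ((T : Set _) + cornerSimplex _) := Set.image_mono hT
      _ = f '' T + f '' cornerSimplex _ := Set.image_add f
      _ ⊆ T.image f + S := by
        rw [Finset.coe_image]
        exact Set.add_subset_add_left
          (linearCombination_image_cornerSimplex_subset hconv h0 hvS)

theorem exists_finset_card_le_sub_subset_add {K : Set E} (hcomp : IsCompact K)
    (hconv : Convex ℝ K) :
    ∃ T : Finset E, T.card ≤ (4 * Module.finrank ℝ E + 1) ^ Module.finrank ℝ E ∧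
      K - K ⊆ T + K := by
  classical
  rcases K.eq_empty_or_nonempty with rfl | ⟨x₀, hx₀⟩
  · exact ⟨∅, by simp⟩
  obtain ⟨T, hTcard, hT⟩ := exists_finset_card_le_sub_subset_add_of_zero_mem
    (hcomp.vadd (-x₀)) (hconv.vadd (-x₀)) ⟨x₀, hx₀, by simp⟩
  refine ⟨-x₀ +ᵥ T, by simpa using hTcard, ?_⟩
  rintro _ ⟨a, ha, b, hb, rfl⟩
  rw [Finset.coe_vadd_finset, vadd_add_assoc, ← add_vadd_comm]
  simpa using hT (Set.sub_mem_sub (Set.vadd_mem_vadd_set ha) (Set.vadd_mem_vadd_set hb))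

end Covering

theorem ncard_inter_le_card_mul_of_subset_add {G : Type*} [AddGroup G] {L A K : Set G}
    {T : Finset G} {M : ℕ} (hA : A ⊆ T + K) (hfin : ∀ v : G, (L ∩ (v +ᵥ K)).Finite)
    (hM : ∀ v : G, (L ∩ (v +ᵥ K)).ncard ≤ M) : (L ∩ A).ncard ≤ T.card * M := by
  have hsub : L ∩ A ⊆ ⋃ t ∈ T, L ∩ (t +ᵥ K) := by
    rw [← Set.inter_iUnion₂]
    refine Set.inter_subset_inter_right L (hA.trans_eq ?_)
    exact (Set.iUnion_vadd_set _ _).symm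
  calc (L ∩ A).ncard ≤ (⋃ t ∈ T, L ∩ (t +ᵥ K)).ncard :=
        Set.ncard_le_ncard hsub (T.finite_toSet.biUnion fun t _ => hfin t)
    _ ≤ ∑ t ∈ T, (L ∩ (t +ᵥ K)).ncard := T.set_ncard_biUnion_le _
    _ ≤ T.card * M := T.sum_le_card_nsmul _ M fun t _ => hM t

theorem ncard_addSubgroup_inter_vadd_le {G : Type*} [AddCommGroup G] (L : AddSubgroup G)
    {K : Set G} (hfin : ((L : Set G) ∩ (K - K)).Finite) (v : G) :
    ((L : Set G) ∩ (v +ᵥ K)).ncard ≤ ((L : Set G) ∩ (K - K)).ncard := by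
  rcases ((L : Set G) ∩ (v +ᵥ K)).eq_empty_or_nonempty with h | ⟨_, hz, b, hb, rfl⟩
  · simp [h]
  refine Set.ncard_le_ncard_of_injOn (· - (v +ᵥ b)) ?_ sub_left_injective.injOn hfin
  rintro _ ⟨hx, a, ha, rfl⟩
  exact ⟨L.sub_mem hx hz, a, ha, b, hb, by simp⟩

theorem finite_addSubgroup_inter_of_isCompact {G : Type*} [AddGroup G] [TopologicalSpace G]
    [IsTopologicalAddGroup G] [T2Space G] (L : AddSubgroup G) [DiscreteTopology L] {s : Set G}
    (hs : IsCompact s) : ((L : Set G) ∩ s).Finite :=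
  (hs.inter_left L.isClosed_of_discrete).finite
    (DiscreteTopology.isDiscrete.mono Set.inter_subset_left)

theorem integerLattice_eq_span (d : ℕ) : integerLattice d =
    (Submodule.span ℤ
      (Set.range (EuclideanSpace.basisFun (Fin d) ℝ).toBasis)).toAddSubgroup := by
  ext x
  rw [Submodule.coe_toAddSubgroup, SetLike.mem_coe, Module.Basis.mem_span_iff_repr_mem]
  simp [integerLattice, eq_comm]

theorem mainTheorem8_general {E : Type*} [AddCommGroup E] [Module ℝ E] [TopologicalSpace E]
    [IsTopologicalAddGroup E] [ContinuousSMul ℝ E] [T2Space E] [FiniteDimensional ℝ E]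
    (L : AddSubgroup E) [DiscreteTopology L] (K : ConvexBody E) :
    (∀ v : E, ((L : Set E) ∩ (v +ᵥ (K : Set E))).Finite) ∧
    ((L : Set E) ∩ ((K : Set E) - (K : Set E))).Finite ∧
    ∃ M : ℕ,
      IsGreatest (Set.range fun v : E => ((L : Set E) ∩ (v +ᵥ (K : Set E))).ncard) M ∧
      M ≤ ((L : Set E) ∩ ((K : Set E) - (K : Set E))).ncard ∧
      (((L : Set E) ∩ ((K : Set E) - (K : Set E))).ncard : ℝ) ≤
        (4 * Module.finrank ℝ E + 1) ^ Module.finrank ℝ E * M := by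
  have hfin (v : E) := finite_addSubgroup_inter_of_isCompact L (K.isCompact.vadd v)
  have hfin_sub : ((L : Set E) ∩ ((K : Set E) - (K : Set E))).Finite := by
    rw [sub_eq_add_neg]
    exact finite_addSubgroup_inter_of_isCompact L (K.isCompact.add K.isCompact.neg)
  have hle := ncard_addSubgroup_inter_vadd_le L hfin_sub
  obtain ⟨M, hM⟩ : ∃ M, IsGreatest
      (Set.range fun v : E => ((L : Set E) ∩ (v +ᵥ (K : Set E))).ncard) M :=
    BddAbove.exists_isGreatest_of_nonempty ⟨_, Set.forall_mem_range.mpr hle⟩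
      (Set.range_nonempty _)
  obtain ⟨T, hTcard, hT⟩ := exists_finset_card_le_sub_subset_add K.isCompact K.convex
  refine ⟨hfin, hfin_sub, M, hM, ?_, ?_⟩
  · obtain ⟨v, hv⟩ := hM.1
    exact hv ▸ hle v
  · have hcover := ncard_inter_le_card_mul_of_subset_add hT hfin fun v =>
      hM.2 (Set.mem_range_self v)
    exact_mod_cast hcover.trans (Nat.mul_le_mul_right M hTcard)

theorem mainTheorem8 (d : ℕ) :
    ∃ C : ℝ, 0 < C ∧
      ∀ K : ConvexBody (EuclideanSpace ℝ (Fin d)),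
        (interior (K : Set (EuclideanSpace ℝ (Fin d)))).Nonempty →
        (∀ v : EuclideanSpace ℝ (Fin d),
          (integerLattice d ∩ (v +ᵥ (K : Set (EuclideanSpace ℝ (Fin d))))).Finite) ∧
        (integerLattice d ∩ ((K : Set (EuclideanSpace ℝ (Fin d))) -
          (K : Set (EuclideanSpace ℝ (Fin d))))).Finite ∧
        ∃ M : ℕ,
          IsGreatest (Set.range fun v : EuclideanSpace ℝ (Fin d) =>
            (integerLattice d ∩ (v +ᵥ (K : Set (EuclideanSpace ℝ (Fin d))))).ncard) M ∧
          M ≤ (integerLattice d ∩ ((K : Set (EuclideanSpace ℝ (Fin d))) -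
            (K : Set (EuclideanSpace ℝ (Fin d))))).ncard ∧
          ((integerLattice d ∩ ((K : Set (EuclideanSpace ℝ (Fin d))) -
            (K : Set (EuclideanSpace ℝ (Fin d))))).ncard : ℝ) ≤ C * (M : ℝ) := by
  simp only [integerLattice_eq_span]
  refine ⟨_, ?_, fun K _ => mainTheorem8_general _ K⟩
  positivity
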